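/- Let $d\in\mathbb N$ and let $\alpha\in\mathbb R$. For an open set $\Omega\subseteq\mathbb R^d$, let $\mathcal E_M(\Omega)$ be the set of nets $(u_\varepsilon)_{\varepsilon\in(0,1]}$ in $\mathcal C^\infty(\Omega)$ (complex valued) such that for every compact $K\subset\Omega$ and every $\beta\in\mathbb N^d$ there is $N\in\mathbb N$ with $\sup_{x\in K}|\partial^\beta u_\varepsilon(x)|\le\varepsilon^{-N}$ for small $\varepsilon$, and let $\mathcal N(\Omega)$ be the set of those nets for which, for every compact $K\subset\Omega$, every $\beta\in\mathbb N^d$ and every $m\in\mathbb N$, $\sup_{x\in K}|\partial^\beta u_\varepsilon(x)|\le\varepsilon^{m}$ for small $\varepsilon$. Let $\mathcal G(\Omega)=\mathcal E_M(\Omega)/\mathcal N(\Omega)$ be the special Colombeau algebra on $\Omega$. Let $\widetilde{\mathbb C}$ be the ring of Colombeau generalized numbers, i.e. the nets $(c_\varepsilon)_{\varepsilon\in(0,1]}$ in $\mathbb C$ with $|c_\varepsilon|\le\varepsilon^{-N}$ for small $\varepsilon$, for some $N\in\mathbb N$, modulo those with $|c_\varepsilon|\le\varepsilon^{m}$ for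 small $\varepsilon$, for every $m\in\mathbb N$. For $f\in\mathcal G(\Omega)$ and $\phi\in\mathcal D(\Omega)$ (the smooth compactly supported functions), $\int_\Omega f\phi\in\widetilde{\mathbb C}$ is defined on representatives. Elements $f,g\in\mathcal G(\Omega)$ are called equal in the sense of generalized distributions if $\int_\Omega f\phi=\int_\Omega g\phi$ in $\widetilde{\mathbb C}$ for every $\phi\in\mathcal D(\Omega)$. For $\Omega=\mathbb R^d$ or $\Omega=\mathbb R^d\setminus\{0\}$, $f\in\mathcal G(\Omega)$ is called weakly homogeneous of degree $\alpha$ if $$\int_\Omega f(\lambda x)\phi(x)\,dx=\int_\Omega\lambda^\alpha f(x)\phi(x)\,dx\quad\text{in }\widetilde{\mathbb C}$$ for every real $\lambda>0$ and every $\phi\in\mathcal D(\Omega)$. Let $\mathcal E_\tau(\mathbb R^d)$ be the set of nets $(u_\varepsilon)_{\varepsilon\in(0,1]}$ in $\mathcal C^\infty(\mathbb R^d)$ such that for every $\beta\in\mathbb N^d$ there is $N\in\mathbb N$ with $\sup_{x\in\mathbb R^d}|\partial^\beta u_\varepsilon(x)|(1+|x|)^{-N}\le\varepsilon^{-N}$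 for small $\varepsilon$. **Corollary.** Let $f\in\mathcal G(\mathbb R^d)$ be such that $f|_{\mathbb R^d\setminus\{0\}}\in\mathcal G(\mathbb R^d\setminus\{0\})$ is weakly homogeneous of degree $\alpha$. Then $f$ is equal in the sense of generalized distributions to some $h\in\mathcal G(\mathbb R^d)$ that admits a representative $(h_\varepsilon)_\varepsilon\in\mathcal E_\tau(\mathbb R^d)$. -/

import Mathlib

open Set Filter Topology MeasureTheory TopologicalSpace
open scoped ContDiff Distributions

namespace Colombeau

/-- The index set `(0,1]` of the nets. -/
abbrev Idx : Type := Set.Ioc (0 : ℝ) 1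

/-- The filter "for small `ε`": a property holds along it iff it holds for all
`ε ∈ (0, η]`, for some `η > 0` (see `eventually_small_iff`). -/
def small : Filter Idx := Filter.comap (fun ε : Idx => (ε : ℝ)) (𝓝 0)

/-- `ℝ^d` with its Euclidean norm. -/
abbrev Space (d : ℕ) : Type := EuclideanSpace ℝ (Fin d)

theorem eventually_small_iff {P : Idx → Prop} :
    (∀ᶠ ε in small, P ε) ↔ ∃ η : ℝ, 0 < η ∧ ∀ ε : Idx, (ε : ℝ) ≤ η → P ε := by
  unfold small
  rw [(Metric.nhds_basis_closedBall.comap (fun ε : Idx => (ε : ℝ))).eventually_iff]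
  refine exists_congr fun η => and_congr_right fun _ => ?_
  refine forall_congr' fun ε => ?_
  simp [abs_of_pos ε.2.1]

theorem eventually_const_mul_inv_pow_le (C : ℝ) (N : ℕ) :
    ∀ᶠ ε : Idx in small, C * (ε : ℝ)⁻¹ ^ N ≤ (ε : ℝ)⁻¹ ^ (N + 1) := by
  rw [eventually_small_iff]
  refine ⟨(|C| + 1)⁻¹, by positivity, fun ε h => ?_⟩
  have hε : 0 < (ε : ℝ) := ε.2.1
  have h1 : |C| + 1 ≤ (ε : ℝ)⁻¹ := (le_inv_comm₀ hε (by positivity)).1 h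
  rw [pow_succ, mul_comm]
  gcongr
  linarith [le_abs_self C]

theorem eventually_const_mul_pow_le (C : ℝ) (m : ℕ) :
    ∀ᶠ ε : Idx in small, C * (ε : ℝ) ^ (m + 1) ≤ (ε : ℝ) ^ m := by
  rw [eventually_small_iff]
  refine ⟨(|C| + 1)⁻¹, by positivity, fun ε h => ?_⟩
  have hε : 0 < (ε : ℝ) := ε.2.1
  have h1 : |C| + 1 ≤ (ε : ℝ)⁻¹ := (le_inv_comm₀ hε (by positivity)).1 h
  have h2 : C * (ε : ℝ) ≤ 1 := by
    have : C ≤ (ε : ℝ)⁻¹ := by linarith [le_abs_self C]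
    calc C * (ε : ℝ) ≤ (ε : ℝ)⁻¹ * ε := by gcongr
      _ = 1 := inv_mul_cancel₀ hε.ne'
  calc C * (ε : ℝ) ^ (m + 1) = (C * ε) * (ε : ℝ) ^ m := by ring
    _ ≤ 1 * (ε : ℝ) ^ m := by gcongr
    _ = (ε : ℝ) ^ m := one_mul _

theorem inv_pow_le_inv_pow (ε : Idx) {N M : ℕ} (h : N ≤ M) :
    (ε : ℝ)⁻¹ ^ N ≤ (ε : ℝ)⁻¹ ^ M :=
  pow_le_pow_right₀ ((one_le_inv₀ ε.2.1).2 ε.2.2) h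

/-! ### Generalized complex numbers -/

/-- The moderate nets of complex numbers. -/
def moderateConst : Submodule ℂ (Idx → ℂ) where
  carrier := {c | ∃ N : ℕ, ∀ᶠ ε in small, ‖c ε‖ ≤ (ε : ℝ)⁻¹ ^ N}
  zero_mem' := ⟨0, by simp⟩
  add_mem' := by
    rintro a b ⟨N, hN⟩ ⟨M, hM⟩
    refine ⟨max N M + 1, ?_⟩
    filter_upwards [hN, hM, eventually_const_mul_inv_pow_le 2 (max N M)] with ε h1 h2 h3
    have h4 := inv_pow_le_inv_pow ε (le_max_left N M)
    have h5 := inv_pow_le_inv_pow ε (le_max_right N M)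
    have h6 := norm_add_le (a ε) (b ε)
    simp only [Pi.add_apply]
    linarith
  smul_mem' := by
    rintro c a ⟨N, hN⟩
    refine ⟨N + 1, ?_⟩
    filter_upwards [hN, eventually_const_mul_inv_pow_le ‖c‖ N] with ε h1 h2
    rw [Pi.smul_apply, norm_smul]
    exact (mul_le_mul_of_nonneg_left h1 (norm_nonneg c)).trans h2

/-- The negligible nets of complex numbers. -/
def negligibleConst : Submodule ℂ moderateConst where
  carrier := {c | ∀ m : ℕ, ∀ᶠ ε in small, ‖c.1 ε‖ ≤ (ε : ℝ) ^ m}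
  zero_mem' := fun m => Eventually.of_forall fun ε => by
    have := ε.2.1.le
    simp only [ZeroMemClass.coe_zero, Pi.zero_apply, norm_zero]
    positivity
  add_mem' := by
    intro a b ha hb m
    filter_upwards [ha (m + 1), hb (m + 1), eventually_const_mul_pow_le 2 m] with ε h1 h2 h3
    have h6 := norm_add_le (a.1 ε) (b.1 ε)
    simp only [Submodule.coe_add, Pi.add_apply]
    linarith
  smul_mem' := by
    intro c a ha m
    filter_upwards [ha (m + 1), eventually_const_mul_pow_le ‖c‖ m] with ε h1 h2
    simp only [Submodule.coe_smul, Pi.smul_apply]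
    rw [norm_smul]
    exact (mul_le_mul_of_nonneg_left h1 (norm_nonneg c)).trans h2

/-- The Colombeau generalized complex numbers. -/
abbrev GenConst : Type := moderateConst ⧸ negligibleConst

/-! ### The special Colombeau algebra -/

variable {d : ℕ}

/-- The moderate nets of smooth functions on `Ω`. The members of a net are functions on the whole
space that are smooth on `Ω`; their values off `Ω` are irrelevant, two nets that agree on `Ω`
being identified in the quotient `GenFun Ω`. -/
def moderate (Ω : Opens (Space d)) : Submodule ℂ (Idx → Space d → ℂ) where
  carrier := {u | (∀ ε, ContDiffOn ℝ ∞ (u ε) Ω) ∧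
    ∀ K : Set (Space d), IsCompact K → K ⊆ Ω → ∀ n : ℕ, ∃ N : ℕ,
      ∀ᶠ ε in small, ∀ x ∈ K, ‖iteratedFDeriv ℝ n (u ε) x‖ ≤ (ε : ℝ)⁻¹ ^ N}
  zero_mem' := by
    refine ⟨fun ε => contDiffOn_const, fun K _ _ n => ⟨0, Eventually.of_forall fun ε x _ => ?_⟩⟩
    simp
  add_mem' := by
    rintro a b ⟨ha, ha'⟩ ⟨hb, hb'⟩
    refine ⟨fun ε => (ha ε).add (hb ε), fun K hK hKΩ n => ?_⟩
    obtain ⟨N, hN⟩ := ha' K hK hKΩ n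
    obtain ⟨M, hM⟩ := hb' K hK hKΩ n
    refine ⟨max N M + 1, ?_⟩
    filter_upwards [hN, hM, eventually_const_mul_inv_pow_le 2 (max N M)] with ε h1 h2 h3 x hx
    have h4 := inv_pow_le_inv_pow ε (le_max_left N M)
    have h5 := inv_pow_le_inv_pow ε (le_max_right N M)
    have hxΩ := Ω.isOpen.mem_nhds (hKΩ hx)
    rw [Pi.add_apply, iteratedFDeriv_add_apply
      (((ha ε).contDiffAt hxΩ).of_le (by exact_mod_cast le_top))
      (((hb ε).contDiffAt hxΩ).of_le (by exact_mod_cast le_top))]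
    have h6 := norm_add_le (iteratedFDeriv ℝ n (a ε) x) (iteratedFDeriv ℝ n (b ε) x)
    linarith [h1 x hx, h2 x hx]
  smul_mem' := by
    rintro c a ⟨ha, ha'⟩
    refine ⟨fun ε => (ha ε).const_smul c, fun K hK hKΩ n => ?_⟩
    obtain ⟨N, hN⟩ := ha' K hK hKΩ n
    refine ⟨N + 1, ?_⟩
    filter_upwards [hN, eventually_const_mul_inv_pow_le ‖c‖ N] with ε h1 h2 x hx
    have hxΩ := Ω.isOpen.mem_nhds (hKΩ hx)
    rw [Pi.smul_apply, iteratedFDeriv_const_smul_apply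
      (((ha ε).contDiffAt hxΩ).of_le (by exact_mod_cast le_top)), norm_smul]
    exact (mul_le_mul_of_nonneg_left (h1 x hx) (norm_nonneg c)).trans h2

theorem contDiffAt_of_moderate {Ω : Opens (Space d)} (u : moderate Ω) (ε : Idx) {x : Space d}
    (hx : x ∈ Ω) (n : ℕ) : ContDiffAt ℝ n (u.1 ε) x :=
  ((u.2.1 ε).contDiffAt (Ω.isOpen.mem_nhds hx)).of_le (by exact_mod_cast le_top)

/-- The negligible nets of smooth functions on `Ω`. -/
def negligible (Ω : Opens (Space d)) : Submodule ℂ (moderate Ω) where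
  carrier := {u | ∀ K : Set (Space d), IsCompact K → K ⊆ Ω → ∀ n m : ℕ,
      ∀ᶠ ε in small, ∀ x ∈ K, ‖iteratedFDeriv ℝ n (u.1 ε) x‖ ≤ (ε : ℝ) ^ m}
  zero_mem' := by
    refine fun K _ _ n m => Eventually.of_forall fun ε x _ => ?_
    have := ε.2.1.le
    have h : ((0 : moderate Ω).1 ε) = fun _ => (0 : ℂ) := rfl
    rw [h, iteratedFDeriv_fun_zero]
    simp only [Pi.zero_apply, norm_zero]
    positivity
  add_mem' := by
    intro a b ha hb K hK hKΩ n m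
    filter_upwards [ha K hK hKΩ n (m + 1), hb K hK hKΩ n (m + 1),
      eventually_const_mul_pow_le 2 m] with ε h1 h2 h3 x hx
    have h : (a + b).1 ε = a.1 ε + b.1 ε := rfl
    rw [h, iteratedFDeriv_add_apply (contDiffAt_of_moderate a ε (hKΩ hx) n) (contDiffAt_of_moderate b ε (hKΩ hx) n)]
    have h6 := norm_add_le (iteratedFDeriv ℝ n (a.1 ε) x) (iteratedFDeriv ℝ n (b.1 ε) x)
    linarith [h1 x hx, h2 x hx]
  smul_mem' := by
    intro c a ha K hK hKΩ n m
    filter_upwards [ha K hK hKΩ n (m + 1), eventually_const_mul_pow_le ‖c‖ m] with ε h1 h2 x hx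
    have h : (c • a).1 ε = c • a.1 ε := rfl
    rw [h, iteratedFDeriv_const_smul_apply (contDiffAt_of_moderate a ε (hKΩ hx) n), norm_smul]
    exact (mul_le_mul_of_nonneg_left (h1 x hx) (norm_nonneg c)).trans h2

/-- The space `𝒢(Ω)` of generalized functions on `Ω` (the special Colombeau algebra). -/
abbrev GenFun (Ω : Opens (Space d)) : Type := moderate Ω ⧸ negligible Ω

/-- The generalized function with a given representative. -/
abbrev GenFun.mk {Ω : Opens (Space d)} (u : moderate Ω) : GenFun Ω := (negligible Ω).mkQ u

/-! ### Restriction -/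

/-- Restriction of nets. -/
def restrictNet {U V : Opens (Space d)} (h : V ≤ U) : moderate U →ₗ[ℂ] moderate V where
  toFun u := ⟨u.1, fun ε => (u.2.1 ε).mono h, fun K hK hKV => u.2.2 K hK (hKV.trans h)⟩
  map_add' _ _ := rfl
  map_smul' _ _ := rfl

/-- Restriction of a generalized function to a smaller open set. -/
def GenFun.restrict {U V : Opens (Space d)} (h : V ≤ U) : GenFun U →ₗ[ℂ] GenFun V :=
  (negligible U).mapQ (negligible V) (restrictNet h)
    fun _ hu K hK hKV => hu K hK (hKV.trans h)

/-! ### Dilation -/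

/-- An open set stable under multiplication by positive real numbers. -/
def IsConic (Ω : Opens (Space d)) : Prop := ∀ r : ℝ, 0 < r → ∀ x ∈ Ω, r • x ∈ Ω

theorem norm_iteratedFDeriv_dilate_le (u : Space d → ℂ) {r : ℝ} (hr : 0 < r) (n : ℕ)
    (x : Space d) :
    ‖iteratedFDeriv ℝ n (fun y => u (r • y)) x‖ ≤ r ^ n * ‖iteratedFDeriv ℝ n u (r • x)‖ := by
  let g : Space d ≃L[ℝ] Space d := ContinuousLinearEquiv.smulLeft (Units.mk0 r hr.ne')
  have hg : ∀ y, g y = r • y := fun y => rfl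
  have h := g.iteratedFDerivWithin_comp_right u uniqueDiffOn_univ (x := x) (mem_univ _) n
  rw [preimage_univ, iteratedFDerivWithin_univ, iteratedFDerivWithin_univ] at h
  have h' : (u ∘ g) = fun y => u (r • y) := rfl
  rw [← h', h]
  refine (ContinuousMultilinearMap.norm_compContinuousLinearMap_le _ _).trans ?_
  rw [mul_comm, hg]
  gcongr
  rw [Finset.prod_const, Finset.card_univ, Fintype.card_fin]
  gcongr
  refine ContinuousLinearMap.opNorm_le_bound _ hr.le fun y => ?_
  change ‖r • y‖ ≤ _
  rw [norm_smul, Real.norm_of_nonneg hr.le]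

/-- The net `x ↦ u_ε(r x)`. -/
def dilateNet {Ω : Opens (Space d)} (hΩ : IsConic Ω) (r : ℝ) (hr : 0 < r) :
    moderate Ω →ₗ[ℂ] moderate Ω where
  toFun u := ⟨fun ε x => u.1 ε (r • x), by
    refine ⟨fun ε => (u.2.1 ε).comp (contDiff_const_smul r).contDiffOn fun x hx => hΩ r hr x hx,
      fun K hK hKΩ n => ?_⟩
    obtain ⟨N, hN⟩ := u.2.2 ((fun x => r • x) '' K) (hK.image (continuous_const_smul r))
      (by rintro _ ⟨x, hx, rfl⟩; exact hΩ r hr x (hKΩ hx)) n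
    refine ⟨N + 1, ?_⟩
    filter_upwards [hN, eventually_const_mul_inv_pow_le (r ^ n) N] with ε h1 h2 x hx
    refine (norm_iteratedFDeriv_dilate_le _ hr n x).trans (le_trans ?_ h2)
    gcongr
    exact h1 _ (mem_image_of_mem _ hx)⟩
  map_add' _ _ := rfl
  map_smul' _ _ := rfl

/-- The generalized function `x ↦ f(r x)`. -/
def GenFun.dilate {Ω : Opens (Space d)} (hΩ : IsConic Ω) (r : ℝ) (hr : 0 < r) :
    GenFun Ω →ₗ[ℂ] GenFun Ω :=
  (negligible Ω).mapQ (negligible Ω) (dilateNet hΩ r hr) <| by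
    intro u hu K hK hKΩ n m
    filter_upwards [hu ((fun x => r • x) '' K) (hK.image (continuous_const_smul r))
      (by rintro _ ⟨x, hx, rfl⟩; exact hΩ r hr x (hKΩ hx)) n (m + 1),
      eventually_const_mul_pow_le (r ^ n) m] with ε h1 h2 x hx
    refine (norm_iteratedFDeriv_dilate_le _ hr n x).trans (le_trans ?_ h2)
    gcongr
    exact h1 _ (mem_image_of_mem _ hx)

/-! ### Integration against test functions -/

theorem continuous_mul_test {Ω : Opens (Space d)} {u : Space d → ℂ} (hu : ContDiffOn ℝ ∞ u Ω)
    (φ : 𝓓(Ω, ℂ)) : Continuous fun x => u x * φ x := by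
  refine continuous_of_tsupport fun x hx => ?_
  have hx' : x ∈ Ω := φ.tsupport_subset (tsupport_mul_subset_right hx)
  exact (hu.continuousOn.continuousAt (Ω.isOpen.mem_nhds hx')).mul φ.continuous.continuousAt

theorem integrable_mul_test {Ω : Opens (Space d)} {u : Space d → ℂ} (hu : ContDiffOn ℝ ∞ u Ω)
    (φ : 𝓓(Ω, ℂ)) : Integrable (fun x => u x * φ x) :=
  (continuous_mul_test hu φ).integrable_of_hasCompactSupport φ.hasCompactSupport.mul_left

theorem norm_integral_mul_test_le {Ω : Opens (Space d)} {u : Space d → ℂ} (φ : 𝓓(Ω, ℂ))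
    {B : ℝ} (hB : ∀ x ∈ tsupport φ, ‖iteratedFDeriv ℝ 0 u x‖ ≤ B) :
    ‖∫ x in (Ω : Set (Space d)), u x * φ x‖ ≤
      (∫ x in (Ω : Set (Space d)), ‖φ x‖) * B := by
  rw [← integral_mul_const]
  refine norm_integral_le_of_norm_le ?_ (Eventually.of_forall fun x => ?_)
  · exact ((φ.continuous.norm.integrable_of_hasCompactSupport
      φ.hasCompactSupport.norm).mul_const B).integrableOn
  · rw [norm_mul, mul_comm]
    by_cases hx : x ∈ tsupport φ
    · have := hB x hx
      rw [norm_iteratedFDeriv_zero] at this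
      gcongr
    · simp [image_eq_zero_of_notMem_tsupport hx]

/-- The net `ε ↦ ∫_Ω u_ε φ`. -/
noncomputable def pairingNet {Ω : Opens (Space d)} (φ : 𝓓(Ω, ℂ)) :
    moderate Ω →ₗ[ℂ] moderateConst where
  toFun u := ⟨fun ε => ∫ x in (Ω : Set (Space d)), u.1 ε x * φ x, by
    obtain ⟨N, hN⟩ := u.2.2 (tsupport φ) φ.hasCompactSupport φ.tsupport_subset 0
    refine ⟨N + 1, ?_⟩
    filter_upwards [hN, eventually_const_mul_inv_pow_le
      (∫ x in (Ω : Set (Space d)), ‖φ x‖) N] with ε h1 h2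
    exact (norm_integral_mul_test_le φ h1).trans h2⟩
  map_add' u v := by
    ext ε
    change ∫ x in (Ω : Set (Space d)), (u.1 ε x + v.1 ε x) * φ x =
      (∫ x in (Ω : Set (Space d)), u.1 ε x * φ x) + ∫ x in (Ω : Set (Space d)), v.1 ε x * φ x
    rw [← integral_add (integrable_mul_test (u.2.1 ε) φ).integrableOn
      (integrable_mul_test (v.2.1 ε) φ).integrableOn]
    simp only [add_mul]
  map_smul' c u := by
    ext ε
    change ∫ x in (Ω : Set (Space d)), (c * u.1 ε x) * φ x =
      c * ∫ x in (Ω : Set (Space d)), u.1 ε x * φ x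
    rw [← integral_const_mul]
    simp only [mul_assoc]

/-- The generalized number `∫_Ω f φ`, for a generalized function `f` and a test function `φ`. -/
noncomputable def GenFun.pairing {Ω : Opens (Space d)} (φ : 𝓓(Ω, ℂ)) :
    GenFun Ω →ₗ[ℂ] GenConst :=
  (negligible Ω).mapQ negligibleConst (pairingNet φ) <| by
    intro u hu m
    filter_upwards [hu (tsupport φ) φ.hasCompactSupport φ.tsupport_subset 0 (m + 1),
      eventually_const_mul_pow_le (∫ x in (Ω : Set (Space d)), ‖φ x‖) m] with ε h1 h2
    exact (norm_integral_mul_test_le φ h1).trans h2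

/-- Equality in the sense of generalized distributions. -/
def EqGenDistr {Ω : Opens (Space d)} (f g : GenFun Ω) : Prop :=
  ∀ φ : 𝓓(Ω, ℂ), GenFun.pairing φ f = GenFun.pairing φ g

/-! ### Weak homogeneity -/

/-- `f` is weakly homogeneous of degree `α`: for all `r > 0` and all test functions `φ`,
`∫ f(r x) φ(x) dx = ∫ r^α f(x) φ(x) dx` as generalized numbers. -/
def IsWeaklyHomogeneous {Ω : Opens (Space d)} (hΩ : IsConic Ω) (α : ℝ) (f : GenFun Ω) : Prop :=
  ∀ (r : ℝ) (hr : 0 < r) (φ : 𝓓(Ω, ℂ)),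
    GenFun.pairing φ (GenFun.dilate hΩ r hr f) = GenFun.pairing φ (((r ^ α : ℝ) : ℂ) • f)

/-- `ℝ^d ∖ {0}`. -/
def punctured (d : ℕ) : Opens (Space d) := ⟨{0}ᶜ, isOpen_compl_singleton⟩

theorem isConic_punctured (d : ℕ) : IsConic (punctured d) :=
  fun _ hr _ hx => smul_ne_zero hr.ne' hx

/-! ### Polynomial growth -/

/-- The set `ℰ_τ(ℝ^d)` of nets of smooth functions of moderate polynomial growth. -/
def Etau (d : ℕ) : Set (Idx → Space d → ℂ) :=
  {u | (∀ ε, ContDiff ℝ ∞ (u ε)) ∧ ∀ n : ℕ, ∃ N : ℕ, ∀ᶠ ε in small, ∀ x,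
    ‖iteratedFDeriv ℝ n (u ε) x‖ * (1 + ‖x‖)⁻¹ ^ N ≤ (ε : ℝ)⁻¹ ^ N}

end Colombeau

namespace Colombeau

/-! ### A dyadic partition of unity -/

/-! Let `u` represent `f`, let `χ` be `cutoff` and `ψ = χ - χ(2 ·)` be `annular`, so that `χ + ∑ j,
ψ(r_j ·) = 1` with `r_j = 2 ^ (-(j + 1))`, a locally finite sum. The representative sought is `h_ε =
u_ε χ + ∑ j, r_j ^ (-α) u_ε(r_j ·) ψ(r_j ·)`: each piece `u_ε ψ(r_j ·)` is replaced by what exact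
homogeneity would make it.

Growth: `h_ε` sees `u_ε` only on the ball of radius `2`, where moderateness bounds every derivative
by a power of `1/ε`. Since `r_j ≤ 1`, dilation does not increase derivatives; growth in `x` comes
only from the weights `r_j ^ (-α)` and the number of shells involved, both polynomial in `1 + ‖x‖`
(`norm_iteratedFDeriv_homogExt_le`, `homogExt_mem_Etau`).

Equality: the support of a test function `φ` meets finitely many shells, their number independent of
`ε`. The error on shell `j` is `r_j ^ (-α)` times the homogeneity defect of `u` for the ratio `r_j`,
tested against `ψ(r_j ·) φ`, which is supported off the origin; weak homogeneity makes it negligible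
(`shellDefect_apply`, `eqGenDistr_homogExt`). Only single dyadic ratios occur, so no uniformity in
the ratio is needed. -/

/-- A smooth function equal to `1` on the unit ball, with compact support. -/
noncomputable def cutoff (d : ℕ) (x : Space d) : ℂ :=
  (((⟨1, 2, one_pos, one_lt_two⟩ : ContDiffBump (0 : Space d)) x : ℝ) : ℂ)

/-- A smooth function with compact support off the origin, whose dyadic dilations sum up to `1`
away from the origin. -/
noncomputable def annular (d : ℕ) (x : Space d) : ℂ := cutoff d x - cutoff d ((2 : ℝ) • x)

variable {d : ℕ}

theorem contDiff_cutoff : ContDiff ℝ ∞ (cutoff d) :=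
  Complex.ofRealCLM.contDiff.comp (ContDiffBump.contDiff _)

theorem hasCompactSupport_cutoff : HasCompactSupport (cutoff d) :=
  (ContDiffBump.hasCompactSupport _).comp_left (g := fun r : ℝ => (r : ℂ)) Complex.ofReal_zero

theorem cutoff_eq_one {x : Space d} (hx : ‖x‖ ≤ 1) : cutoff d x = 1 := by
  unfold cutoff
  rw [ContDiffBump.one_of_mem_closedBall _ (by simpa using hx), Complex.ofReal_one]

theorem contDiff_annular : ContDiff ℝ ∞ (annular d) :=
  contDiff_cutoff.sub (contDiff_cutoff.comp (contDiff_const_smul _))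

theorem hasCompactSupport_annular : HasCompactSupport (annular d) :=
  hasCompactSupport_cutoff.sub (hasCompactSupport_cutoff.comp_smul two_ne_zero)

theorem annular_eq_zero {x : Space d} (hx : ‖x‖ ≤ 1 / 2) : annular d x = 0 := by
  have h : ‖(2 : ℝ) • x‖ ≤ 1 := by
    rw [norm_smul, Real.norm_two]
    linarith
  rw [annular, cutoff_eq_one h, cutoff_eq_one (by linarith), sub_self]

theorem zero_notMem_tsupport_annular : (0 : Space d) ∉ tsupport (annular d) := by
  rw [notMem_tsupport_iff_eventuallyEq]
  filter_upwards [Metric.closedBall_mem_nhds (0 : Space d) (one_half_pos (α := ℝ))] with x hx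
  exact annular_eq_zero (by simpa using hx)

/-- The scale `2 ^ (-(j + 1))`. -/
noncomputable def dyadicScale (j : ℕ) : ℝ := (2 ^ (j + 1))⁻¹

theorem dyadicScale_pos (j : ℕ) : 0 < dyadicScale j := by
  unfold dyadicScale
  positivity

theorem dyadicScale_le_one (j : ℕ) : dyadicScale j ≤ 1 :=
  inv_le_one_of_one_le₀ (one_le_pow₀ one_le_two)

/-- Telescoping: `annular` at scale `2 ^ (-(j + 1))` is the difference of `cutoff` at the scales `2
^ (-(j + 1))` and `2 ^ (-j)`. -/
theorem sum_annular (J : ℕ) (x : Space d) :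
    ∑ j ∈ Finset.range J, annular d (dyadicScale j • x) =
      cutoff d (((2 : ℝ) ^ J)⁻¹ • x) - cutoff d x := by
  have h := Finset.sum_range_sub (fun j => cutoff d (((2 : ℝ) ^ j)⁻¹ • x)) J
  rw [pow_zero, inv_one, one_smul] at h
  rw [← h]
  refine Finset.sum_congr rfl fun j _ => ?_
  rw [annular, smul_smul, dyadicScale]
  congr 3
  rw [pow_succ]
  field_simp

theorem cutoff_add_sum_annular {J : ℕ} {x : Space d} (hx : ‖x‖ < 2 ^ J) :
    cutoff d x + ∑ j ∈ Finset.range J, annular d (dyadicScale j • x) = 1 := by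
  rw [sum_annular, cutoff_eq_one (x := ((2 : ℝ) ^ J)⁻¹ • x), add_sub_cancel]
  rw [norm_smul, norm_inv, norm_pow, Real.norm_two]
  exact inv_mul_le_one_of_le₀ hx.le (by positivity)

/-! ### Homogeneous extension of a function from a ball -/

/-- The function `u` cut off to a dyadic shell around the unit sphere and extended by homogeneity
to the shell of radius `2 ^ (j + 1)`. -/
noncomputable def shell (α : ℝ) (u : Space d → ℂ) (j : ℕ) (x : Space d) : ℂ :=
  ((dyadicScale j ^ (-α) : ℝ) : ℂ) * (u (dyadicScale j • x) * annular d (dyadicScale j • x))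

/-- The function that agrees with `u` near the origin, and is outside the unit ball assembled from
dilations of `u` in such a way that it equals `u` if `u` is homogeneous of degree `α`. -/
noncomputable def homogExt (α : ℝ) (u : Space d → ℂ) (x : Space d) : ℂ :=
  u x * cutoff d x + ∑' j, shell α u j x

/-- Since `annular` vanishes on the ball of radius `1/2`, the series in `homogExt` is locally
finite. -/
theorem shell_eq_zero (α : ℝ) (u : Space d → ℂ) {j : ℕ} {x : Space d} (hx : ‖x‖ ≤ 2 ^ j) :
    shell α u j x = 0 := by
  rw [shell, annular_eq_zero, mul_zero, mul_zero]
  rw [norm_smul, Real.norm_of_nonneg (dyadicScale_pos j).le, dyadicScale, pow_succ]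
  rw [inv_mul_le_iff₀ (by positivity)]
  linarith

theorem homogExt_eq (α : ℝ) (u : Space d → ℂ) {J : ℕ} {x : Space d} (hx : ‖x‖ < 2 ^ J) :
    homogExt α u x = u x * cutoff d x + ∑ j ∈ Finset.range J, shell α u j x := by
  rw [homogExt, tsum_eq_sum fun j hj => shell_eq_zero α u (hx.le.trans ?_)]
  exact pow_le_pow_right₀ one_le_two (by simpa using hj)

theorem homogExt_eventuallyEq (α : ℝ) (u : Space d → ℂ) {J : ℕ} {x : Space d}
    (hx : ‖x‖ < 2 ^ J) :
    homogExt α u =ᶠ[𝓝 x] fun y => u y * cutoff d y + ∑ j ∈ Finset.range J, shell α u j y := by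
  filter_upwards [(isOpen_lt continuous_norm continuous_const).mem_nhds hx] with y hy
  exact homogExt_eq α u hy

theorem contDiff_shell (α : ℝ) {u : Space d → ℂ} (hu : ContDiff ℝ ∞ u) (j : ℕ) :
    ContDiff ℝ ∞ (shell α u j) :=
  contDiff_const.mul ((hu.comp (contDiff_const_smul _)).mul
    (contDiff_annular.comp (contDiff_const_smul _)))

theorem contDiff_homogExt (α : ℝ) {u : Space d → ℂ} (hu : ContDiff ℝ ∞ u) :
    ContDiff ℝ ∞ (homogExt α u) := by
  rw [contDiff_iff_contDiffAt]
  intro x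
  obtain ⟨J, hJ⟩ := pow_unbounded_of_one_lt ‖x‖ (one_lt_two (α := ℝ))
  refine ContDiffAt.congr_of_eventuallyEq ?_ (homogExt_eventuallyEq α u hJ)
  exact ((hu.mul contDiff_cutoff).add (ContDiff.sum fun j _ => contDiff_shell α hu j)).contDiffAt

/-- The weight is `2 ^ ((j + 1) α)`; taking `|α|` gives one natural exponent that serves both signs
of `α`. -/
theorem dyadicScale_rpow_neg_le (α : ℝ) {j J : ℕ} (hj : j < J) :
    dyadicScale j ^ (-α) ≤ ((2 : ℝ) ^ J) ^ ⌈|α|⌉₊ := by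
  have h1 : (1 : ℝ) ≤ 2 ^ (j + 1) := one_le_pow₀ one_le_two
  rw [dyadicScale, Real.inv_rpow (by positivity), Real.rpow_neg (by positivity), inv_inv]
  calc ((2 : ℝ) ^ (j + 1)) ^ α ≤ ((2 : ℝ) ^ (j + 1)) ^ ((⌈|α|⌉₊ : ℕ) : ℝ) :=
        Real.rpow_le_rpow_of_exponent_le h1 ((le_abs_self α).trans (Nat.le_ceil _))
    _ = ((2 : ℝ) ^ (j + 1)) ^ ⌈|α|⌉₊ := Real.rpow_natCast _ _
    _ ≤ ((2 : ℝ) ^ J) ^ ⌈|α|⌉₊ := by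
        gcongr
        · exact one_le_two
        · exact hj

theorem norm_iteratedFDeriv_const_smul_dilate_le {g : Space d → ℂ} {n : ℕ} (hg : ContDiff ℝ n g)
    {r c C : ℝ} (hr : 0 < r) (hr' : r ≤ 1) (hc : 0 ≤ c) (hC : ∀ x, ‖iteratedFDeriv ℝ n g x‖ ≤ C)
    (x : Space d) : ‖iteratedFDeriv ℝ n ((c : ℂ) • fun y => g (r • y)) x‖ ≤ c * C := by
  have hs : ContDiff ℝ n fun y => g (r • y) := hg.comp (contDiff_const_smul r)
  rw [iteratedFDeriv_const_smul_apply hs.contDiffAt, norm_smul, Complex.norm_real,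
    Real.norm_of_nonneg hc]
  refine mul_le_mul_of_nonneg_left ((norm_iteratedFDeriv_dilate_le g hr n x).trans ?_) hc
  exact (mul_le_of_le_one_left (norm_nonneg _) (pow_le_one₀ hr.le hr')).trans (hC _)

theorem norm_iteratedFDeriv_shell_le (α : ℝ) {u : Space d → ℂ} (hu : ContDiff ℝ ∞ u) {j J n : ℕ}
    (hj : j < J) {C : ℝ} (hC : ∀ x, ‖iteratedFDeriv ℝ n (fun y => u y * annular d y) x‖ ≤ C)
    (x : Space d) :
    ‖iteratedFDeriv ℝ n (shell α u j) x‖ ≤ ((2 : ℝ) ^ J) ^ ⌈|α|⌉₊ * C := by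
  have hr := dyadicScale_pos j
  have hC0 : 0 ≤ C := (norm_nonneg _).trans (hC 0)
  have hg : ContDiff ℝ n fun y => u y * annular d y :=
    (hu.mul contDiff_annular).of_le (by exact_mod_cast le_top)
  exact (norm_iteratedFDeriv_const_smul_dilate_le hg hr (dyadicScale_le_one j)
    (Real.rpow_nonneg hr.le (-α)) hC x).trans
      (mul_le_mul_of_nonneg_right (dyadicScale_rpow_neg_le α hj) hC0)

/-- The bound is linear in `C` and its other factors do not involve `u`, so for a net all dependence
on `ε` stays in `C`. -/
theorem norm_iteratedFDeriv_homogExt_le (α : ℝ) {u : Space d → ℂ} (hu : ContDiff ℝ ∞ u) {n : ℕ}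
    {C : ℝ} (h₀ : ∀ x, ‖iteratedFDeriv ℝ n (fun y => u y * cutoff d y) x‖ ≤ C)
    (hC : ∀ x, ‖iteratedFDeriv ℝ n (fun y => u y * annular d y) x‖ ≤ C) (x : Space d) :
    ‖iteratedFDeriv ℝ n (homogExt α u) x‖ ≤
      (1 + 2 ^ (⌈|α|⌉₊ + 1)) * C * (1 + ‖x‖) ^ (⌈|α|⌉₊ + 1) := by
  have hC0 : 0 ≤ C := (norm_nonneg _).trans (hC 0)
  have hx1 : 1 ≤ 1 + ‖x‖ := by linarith [norm_nonneg x]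
  -- With `J = k + 1`, `2 ^ J` exceeds `‖x‖`, so only the shells `j < J` matter near `x`, yet it is
  -- at most `2 (1 + ‖x‖)`.
  obtain ⟨k, hk, hk'⟩ := exists_nat_pow_near hx1 (one_lt_two (α := ℝ))
  have hJ : (2 : ℝ) ^ (k + 1) ≤ 2 * (1 + ‖x‖) := by rw [pow_succ]; linarith
  have hJx : ‖x‖ < 2 ^ (k + 1) := by linarith
  generalize k + 1 = J at hJ hJx
  -- Crude count of the shells; it accounts for the `+ 1` in the exponent `⌈|α|⌉₊ + 1`.
  have hJ2 : (J : ℝ) ≤ 2 ^ J := by exact_mod_cast Nat.lt_two_pow_self.le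
  have hle : ((n : ℕ) : ℕ∞ω) ≤ ∞ := by exact_mod_cast le_top
  have hs : ∀ j ∈ Finset.range J, ContDiff ℝ n (shell α u j) :=
    fun j _ => (contDiff_shell α hu j).of_le hle
  have hc : ContDiff ℝ n fun y => u y * cutoff d y := (hu.mul contDiff_cutoff).of_le hle
  have hsum : ‖iteratedFDeriv ℝ n (fun y => ∑ j ∈ Finset.range J, shell α u j y) x‖ ≤
      2 ^ (⌈|α|⌉₊ + 1) * C * (1 + ‖x‖) ^ (⌈|α|⌉₊ + 1) := by
    rw [iteratedFDeriv_fun_sum_apply fun j hj => (hs j hj).contDiffAt]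
    calc _ ≤ ∑ j ∈ Finset.range J, ((2 : ℝ) ^ J) ^ ⌈|α|⌉₊ * C :=
          norm_sum_le_of_le _ fun j hj =>
            norm_iteratedFDeriv_shell_le α hu (Finset.mem_range.1 hj) hC x
      _ = J * ((2 : ℝ) ^ J) ^ ⌈|α|⌉₊ * C := by
          rw [Finset.sum_const, Finset.card_range, nsmul_eq_mul, mul_assoc]
      _ ≤ 2 ^ J * ((2 : ℝ) ^ J) ^ ⌈|α|⌉₊ * C := by gcongr
      _ = ((2 : ℝ) ^ J) ^ (⌈|α|⌉₊ + 1) * C := by rw [pow_succ' ((2 : ℝ) ^ J)]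
      _ ≤ (2 * (1 + ‖x‖)) ^ (⌈|α|⌉₊ + 1) * C := by gcongr
      _ = _ := by rw [mul_pow]; ring
  have hadd : iteratedFDeriv ℝ n
      (fun y => u y * cutoff d y + ∑ j ∈ Finset.range J, shell α u j y) x =
      iteratedFDeriv ℝ n (fun y => u y * cutoff d y) x +
        iteratedFDeriv ℝ n (fun y => ∑ j ∈ Finset.range J, shell α u j y) x :=
    iteratedFDeriv_add_apply hc.contDiffAt (ContDiff.sum hs).contDiffAt
  rw [((homogExt_eventuallyEq α u hJx).iteratedFDeriv ℝ n).eq_of_nhds, hadd]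
  have h1 : C ≤ C * (1 + ‖x‖) ^ (⌈|α|⌉₊ + 1) := le_mul_of_one_le_right hC0 (one_le_pow₀ hx1)
  calc _ ≤ _ := norm_add_le _ _
    _ ≤ C * (1 + ‖x‖) ^ (⌈|α|⌉₊ + 1) + 2 ^ (⌈|α|⌉₊ + 1) * C * (1 + ‖x‖) ^ (⌈|α|⌉₊ + 1) :=
        add_le_add ((h₀ x).trans h1) hsum
    _ = _ := by ring

/-! ### Moderate growth -/

/-- Multiplying by a compactly supported `η` turns moderate bounds on the compact set `tsupport η`
into global ones, by the Leibniz rule. -/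
theorem exists_norm_iteratedFDeriv_mul_le (u : moderate (⊤ : Opens (Space d))) {η : Space d → ℂ}
    (hη : ContDiff ℝ ∞ η) (hη' : HasCompactSupport η) (n : ℕ) :
    ∃ N : ℕ, ∀ᶠ ε in small, ∀ x,
      ‖iteratedFDeriv ℝ n (fun y => u.1 ε y * η y) x‖ ≤ (ε : ℝ)⁻¹ ^ N := by
  have hu : ∀ ε, ContDiff ℝ ∞ (u.1 ε) := fun ε => contDiffOn_univ.1 (u.2.1 ε)
  choose M hM using u.2.2 (tsupport η) hη' (fun _ _ => trivial)
  choose B hB using fun k : ℕ => (hη.continuous_iteratedFDeriv (m := k)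
    (by exact_mod_cast le_top)).bounded_above_of_compact_support (hη'.iteratedFDeriv k)
  have hB0 : ∀ k, 0 ≤ B k := fun k => (norm_nonneg _).trans (hB k 0)
  set L := (Finset.range (n + 1)).sup M
  -- The extra power of `1/ε` absorbs the Leibniz constant.
  refine ⟨L + 1, ?_⟩
  filter_upwards [(Finset.eventually_all (Finset.range (n + 1))).2 fun i _ => hM i,
    eventually_const_mul_inv_pow_le
      (∑ i ∈ Finset.range (n + 1), (n.choose i : ℝ) * B (n - i)) L] with ε h1 h2 x
  by_cases hx : x ∈ tsupport η
  · refine (norm_iteratedFDeriv_mul_le (hu ε) hη x (by exact_mod_cast le_top)).trans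
      (le_trans ?_ h2)
    rw [Finset.sum_mul]
    refine Finset.sum_le_sum fun i hi => ?_
    have h3 := (h1 i hi x hx).trans (inv_pow_le_inv_pow ε (Finset.le_sup (f := M) hi))
    calc _ ≤ (n.choose i : ℝ) * (ε : ℝ)⁻¹ ^ L * B (n - i) :=
          mul_le_mul (mul_le_mul_of_nonneg_left h3 (Nat.cast_nonneg _)) (hB _ x) (norm_nonneg _)
            (mul_nonneg (Nat.cast_nonneg _) (pow_nonneg (inv_nonneg.2 ε.2.1.le) _))
      _ = _ := by ring
  · have h4 : x ∉ tsupport fun y => u.1 ε y * η y := fun h => hx (tsupport_mul_subset_right h)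
    have h5 : iteratedFDeriv ℝ n (fun y => u.1 ε y * η y) x = 0 := by
      by_contra h
      exact h4 (support_iteratedFDeriv_subset n h)
    rw [h5, norm_zero]
    exact pow_nonneg (inv_nonneg.2 ε.2.1.le) _

theorem homogExt_mem_Etau (α : ℝ) (u : moderate (⊤ : Opens (Space d))) :
    (fun ε => homogExt α (u.1 ε)) ∈ Etau d := by
  have hu : ∀ ε, ContDiff ℝ ∞ (u.1 ε) := fun ε => contDiffOn_univ.1 (u.2.1 ε)
  refine ⟨fun ε => contDiff_homogExt α (hu ε), fun n => ?_⟩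
  obtain ⟨N₁, h₁⟩ := exists_norm_iteratedFDeriv_mul_le u contDiff_cutoff
    hasCompactSupport_cutoff n
  obtain ⟨N₂, h₂⟩ := exists_norm_iteratedFDeriv_mul_le u contDiff_annular
    hasCompactSupport_annular n
  set A := ⌈|α|⌉₊ + 1 with hA
  set M := max N₁ N₂ with hM
  -- `Etau` asks for one exponent for both `1/ε` and `1 + ‖x‖`.
  refine ⟨max (M + 1) A, ?_⟩
  filter_upwards [h₁, h₂, eventually_const_mul_inv_pow_le (1 + 2 ^ A) M] with ε g₁ g₂ g₃ x
  have hb := norm_iteratedFDeriv_homogExt_le α (hu ε)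
    (fun y => (g₁ y).trans (inv_pow_le_inv_pow ε (le_max_left N₁ N₂)))
    (fun y => (g₂ y).trans (inv_pow_le_inv_pow ε (le_max_right N₁ N₂))) x
  rw [← hA, ← hM] at hb
  have hx1 : 1 ≤ 1 + ‖x‖ := by linarith [norm_nonneg x]
  rw [inv_pow, ← div_eq_mul_inv, div_le_iff₀ (by positivity)]
  refine hb.trans (mul_le_mul (g₃.trans (inv_pow_le_inv_pow ε (le_max_left _ _)))
    (pow_le_pow_right₀ hx1 (le_max_right _ _)) (by positivity)
    (pow_nonneg (inv_nonneg.2 ε.2.1.le) _))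

theorem Etau_subset_moderate : Etau d ⊆ moderate (⊤ : Opens (Space d)) := by
  rintro u ⟨hu, hu'⟩
  refine ⟨fun ε => (hu ε).contDiffOn, fun K hK _ n => ?_⟩
  obtain ⟨N, hN⟩ := hu' n
  obtain ⟨R, hR⟩ := hK.isBounded.exists_norm_le
  refine ⟨N + 1, ?_⟩
  filter_upwards [hN, eventually_const_mul_inv_pow_le ((1 + R) ^ N) N] with ε h1 h2 x hx
  have h3 := h1 x
  have hx0 := norm_nonneg x
  rw [inv_pow, ← div_eq_mul_inv, div_le_iff₀ (by positivity)] at h3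
  refine (h3.trans ?_).trans h2
  rw [mul_comm]
  have h4 : (0 : ℝ) ≤ (ε : ℝ)⁻¹ ^ N := pow_nonneg (inv_nonneg.2 ε.2.1.le) _
  gcongr
  exact hR x hx

/-! ### Pairing with test functions -/

/-- The product of a test function with the dilated cut-off to a dyadic shell, as a test function
off the origin. -/
noncomputable def shellTest (φ : 𝓓((⊤ : Opens (Space d)), ℂ)) (j : ℕ) :
    𝓓(punctured d, ℂ) where
  toFun x := annular d (dyadicScale j • x) * φ x
  contDiff' := (contDiff_annular.comp (contDiff_const_smul _)).mul φ.contDiff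
  hasCompactSupport' := φ.hasCompactSupport.mul_left
  tsupport_subset' := by
    refine tsupport_mul_subset_left.trans fun x hx => ?_
    rintro rfl
    have h := tsupport_comp_subset_preimage (annular d)
      (continuous_const_smul (dyadicScale j)) hx
    rw [mem_preimage, smul_zero] at h
    exact zero_notMem_tsupport_annular h

theorem integral_punctured_mul_shellTest (v : Space d → ℂ) (φ : 𝓓((⊤ : Opens (Space d)), ℂ))
    (j : ℕ) :
    ∫ x in (punctured d : Set (Space d)), v x * shellTest φ j x =
      ∫ x, v x * (annular d (dyadicScale j • x) * φ x) := by
  refine setIntegral_eq_integral_of_forall_compl_eq_zero fun x hx => ?_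
  rw [image_eq_zero_of_notMem_tsupport fun h => hx ((shellTest φ j).tsupport_subset h), mul_zero]

theorem pairing_mk_eq_iff {Ω : Opens (Space d)} (φ : 𝓓(Ω, ℂ)) (u v : moderate Ω) :
    GenFun.pairing φ (GenFun.mk u) = GenFun.pairing φ (GenFun.mk v) ↔
      pairingNet φ u - pairingNet φ v ∈ negligibleConst :=
  Submodule.Quotient.eq _

/-- The defect of homogeneity of `u` on a dyadic shell, tested against `φ`. -/
noncomputable def shellDefect (α : ℝ) (u : moderate (⊤ : Opens (Space d)))
    (φ : 𝓓((⊤ : Opens (Space d)), ℂ)) (j : ℕ) : moderateConst :=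
  pairingNet (shellTest φ j) (dilateNet (isConic_punctured d) (dyadicScale j) (dyadicScale_pos j)
      (restrictNet le_top u)) -
    pairingNet (shellTest φ j) (((dyadicScale j ^ α : ℝ) : ℂ) • restrictNet le_top u)

theorem shellDefect_mem_negligibleConst {α : ℝ} {u : moderate (⊤ : Opens (Space d))}
    (hu : IsWeaklyHomogeneous (isConic_punctured d) α
      (GenFun.restrict (le_top : punctured d ≤ ⊤) (GenFun.mk u)))
    (φ : 𝓓((⊤ : Opens (Space d)), ℂ)) (j : ℕ) : shellDefect α u φ j ∈ negligibleConst :=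
  (pairing_mk_eq_iff _ _ _).1 (hu (dyadicScale j) (dyadicScale_pos j) (shellTest φ j))

/-- The factor `r_j ^ (-α)` cancels the `r_j ^ α` of the homogeneity relation, which turns the
defect into the error made by `homogExt` on shell `j`. -/
theorem shellDefect_apply (α : ℝ) (u : moderate (⊤ : Opens (Space d)))
    (φ : 𝓓((⊤ : Opens (Space d)), ℂ)) (j : ℕ) (ε : Idx) :
    ((dyadicScale j ^ (-α) : ℝ) : ℂ) * (shellDefect α u φ j).1 ε =
      ∫ x, (shell α (u.1 ε) j x - u.1 ε x * annular d (dyadicScale j • x)) * φ x := by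
  have hr := dyadicScale_pos j
  have hu : Continuous (u.1 ε) := (contDiffOn_univ.1 (u.2.1 ε)).continuous
  have hψ : Continuous fun x => annular d (dyadicScale j • x) :=
    contDiff_annular.continuous.comp (continuous_const_smul _)
  have hi : ∀ v : Space d → ℂ, Continuous v →
      Integrable fun x => v x * (annular d (dyadicScale j • x) * φ x) := fun v hv =>
    (hv.mul (hψ.mul φ.continuous)).integrable_of_hasCompactSupport
      (φ.hasCompactSupport.mul_left.mul_left)
  have h : (shellDefect α u φ j).1 ε =
      (∫ x in (punctured d : Set (Space d)), u.1 ε (dyadicScale j • x) * shellTest φ j x) -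
      ∫ x in (punctured d : Set (Space d)),
        ((dyadicScale j ^ α : ℝ) : ℂ) * u.1 ε x * shellTest φ j x := rfl
  have hc : ((dyadicScale j ^ (-α) : ℝ) : ℂ) * ((dyadicScale j ^ α : ℝ) : ℂ) = 1 := by
    rw [← Complex.ofReal_mul, ← Real.rpow_add hr, neg_add_cancel, Real.rpow_zero,
      Complex.ofReal_one]
  rw [h, integral_punctured_mul_shellTest (fun x => u.1 ε (dyadicScale j • x)),
    integral_punctured_mul_shellTest (fun x => ((dyadicScale j ^ α : ℝ) : ℂ) * u.1 ε x),
    ← integral_sub (hi (fun x => u.1 ε (dyadicScale j • x)) (hu.comp (continuous_const_smul _)))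
      (hi (fun x => ((dyadicScale j ^ α : ℝ) : ℂ) * u.1 ε x) (continuous_const.mul hu)),
    ← integral_const_mul]
  refine integral_congr_ae (Eventually.of_forall fun x => ?_)
  simp only [shell]
  linear_combination (-(u.1 ε x * annular d (dyadicScale j • x) * φ x)) * hc

/-- Where `φ` does not vanish, the first `J` shells and `cutoff` already sum to `1`; splitting `u`
accordingly, the `cutoff` terms cancel. -/
theorem homogExt_sub_mul_test (α : ℝ) (u : Space d → ℂ) {φ : Space d → ℂ} {J : ℕ}
    (hJ : ∀ x, φ x ≠ 0 → ‖x‖ < 2 ^ J) (x : Space d) :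
    homogExt α u x * φ x - u x * φ x =
      ∑ j ∈ Finset.range J,
        (shell α u j x - u x * annular d (dyadicScale j • x)) * φ x := by
  by_cases hx : φ x = 0
  · simp [hx]
  · rw [homogExt_eq α u (hJ x hx), ← Finset.sum_mul, Finset.sum_sub_distrib, ← Finset.mul_sum]
    linear_combination (u x * φ x) * cutoff_add_sum_annular (hJ x hx)

theorem eqGenDistr_homogExt {α : ℝ} {u v : moderate (⊤ : Opens (Space d))}
    (hu : IsWeaklyHomogeneous (isConic_punctured d) α
      (GenFun.restrict (le_top : punctured d ≤ ⊤) (GenFun.mk u)))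
    (hv : v.1 = fun ε => homogExt α (u.1 ε)) : EqGenDistr (GenFun.mk u) (GenFun.mk v) := by
  intro φ
  obtain ⟨R, hR⟩ := φ.hasCompactSupport.isCompact.isBounded.exists_norm_le
  -- `J` depends on `φ` alone, so the error below is a sum of a fixed number of negligible nets.
  obtain ⟨J, hJ⟩ := pow_unbounded_of_one_lt R (one_lt_two (α := ℝ))
  have hφ : ∀ x, φ x ≠ 0 → ‖x‖ < 2 ^ J := fun x hx => (hR x (subset_tsupport _ hx)).trans_lt hJ
  refine ((pairing_mk_eq_iff φ v u).2 ?_).symm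
  have h : pairingNet φ v - pairingNet φ u =
      ∑ j ∈ Finset.range J, ((dyadicScale j ^ (-α) : ℝ) : ℂ) • shellDefect α u φ j := by
    ext ε
    have hu' : ContDiff ℝ ∞ (u.1 ε) := contDiffOn_univ.1 (u.2.1 ε)
    have hl : (pairingNet φ v - pairingNet φ u).1 ε =
        (∫ x in ((⊤ : Opens (Space d)) : Set (Space d)), v.1 ε x * φ x) -
          ∫ x in ((⊤ : Opens (Space d)) : Set (Space d)), u.1 ε x * φ x := rfl
    rw [hl, ← integral_sub (integrable_mul_test (v.2.1 ε) φ).integrableOn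
      (integrable_mul_test (u.2.1 ε) φ).integrableOn, Opens.coe_top, setIntegral_univ, hv]
    simp only [AddSubmonoidClass.coe_finsetSum, Finset.sum_apply, Submodule.coe_smul,
      Pi.smul_apply, smul_eq_mul, shellDefect_apply]
    rw [← integral_finsetSum]
    · exact integral_congr_ae (Eventually.of_forall fun x => homogExt_sub_mul_test α _ hφ x)
    · intro j _
      have hc : Continuous fun x =>
          (shell α (u.1 ε) j x - u.1 ε x * annular d (dyadicScale j • x)) * φ x :=
        ((contDiff_shell α hu' j).continuous.sub (hu'.continuous.mul
          (contDiff_annular.continuous.comp (continuous_const_smul _)))).mul φ.continuous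
      exact hc.integrable_of_hasCompactSupport φ.hasCompactSupport.mul_left
  rw [h]
  exact Submodule.sum_mem _ fun j _ =>
    Submodule.smul_mem _ _ (shellDefect_mem_negligibleConst hu φ j)

end Colombeau

theorem mainTheorem7 (d : ℕ) (α : ℝ) (f : Colombeau.GenFun (⊤ : Opens (Colombeau.Space d)))
    (hf : Colombeau.IsWeaklyHomogeneous (Colombeau.isConic_punctured d) α
      (Colombeau.GenFun.restrict (le_top : Colombeau.punctured d ≤ ⊤) f)) :
    ∃ h : Colombeau.GenFun (⊤ : Opens (Colombeau.Space d)),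
      Colombeau.EqGenDistr f h ∧
      ∃ u : Colombeau.moderate (⊤ : Opens (Colombeau.Space d)),
        Colombeau.GenFun.mk u = h ∧ u.1 ∈ Colombeau.Etau d := by
  obtain ⟨u, rfl⟩ := Submodule.mkQ_surjective _ f
  have hE := Colombeau.homogExt_mem_Etau α u
  exact ⟨_, Colombeau.eqGenDistr_homogExt (v := ⟨_, Colombeau.Etau_subset_moderate hE⟩) hf rfl,
    _, rfl, hE⟩
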